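/- Let $G$ be a finite group. A stem extension of $G$ is a short exact sequence of groups $1\to N\xrightarrow{\iota}\hat G\xrightarrow{\pi} G\to 1$ with $\iota(N)\subseteq Z(\hat G)\cap \hat G'$, and a Schur cover of $G$ is a stem extension for which the order of $\hat G$ is maximal among all stem extensions of $G$. The deep commuting graph $\Delta_D(G)$, formed with a Schur cover $\pi:\tilde G\to G$, is the simple graph with vertex set $G$ in which two distinct elements $x,y\in G$ are adjacent if and only if their preimages under $\pi$ commute in $\tilde G$. Then $G$ has a Schur cover, and, for every choice of the Schur cover, $\Delta_D(G)$ is complete if and only if $G$ is cyclic. -/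

import Mathlib

universe u v

namespace GroupExtension

/-- An extension `1 → N → E → G → 1` is central if the image of `N` lies in the centre of `E`. -/
def IsCentral {N E : Type v} {G : Type u} [Group N] [Group E] [Group G]
    (S : GroupExtension N E G) : Prop :=
  S.inl.range ≤ Subgroup.center E

/-- A stem extension: the image of `N` lies in the centre and in the derived subgroup of `E`. -/
def IsStem {N E : Type v} {G : Type u} [Group N] [Group E] [Group G]
    (S : GroupExtension N E G) : Prop :=
  S.IsCentral ∧ S.inl.range ≤ commutator E

/-- A Schur cover of `G`: a stem extension of `G` of maximal order. The order is taken in `ℕ∞`,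
so that no infinite group is given a spurious finite order. -/
def IsSchurCover {N E : Type v} {G : Type u} [Group N] [Group E] [Group G]
    (S : GroupExtension N E G) : Prop :=
  S.IsStem ∧
    ∀ (N' E' : Type v) [Group N'] [Group E'] (S' : GroupExtension N' E' G),
      S'.IsStem → ENat.card E' ≤ ENat.card E

/-- The deep commuting graph of `G`, read off from an extension `S` of `G` (to be used with `S` a
Schur cover): the vertices are the elements of `G`, and distinct `x`, `y` are adjacent if their
preimages commute. -/
def deepCommutingGraph {N E : Type v} {G : Type u} [Group N] [Group E] [Group G]
    (S : GroupExtension N E G) : SimpleGraph G where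
  Adj x y := x ≠ y ∧ ∀ a b : E, S.rightHom a = x → S.rightHom b = y → Commute a b
  symm := ⟨fun _ _ h => ⟨h.1.symm, fun a b ha hb => (h.2 b a hb ha).symm⟩⟩
  loopless := ⟨fun _ h => h.1 rfl⟩

end GroupExtension

/-! In a central extension a commutator depends only on the images in `G`, so the graph is complete
exactly when the cover `E` is abelian. A central extension of a cyclic group is abelian. Conversely,
in an abelian stem extension the kernel lies in `E' = 1`, so `E ≃* G`; were `G` not cyclic, it would
map onto `(ZMod d)²` with `1 < d`, and the cocycle `a x * b y` would give a stem extension of order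
`d * |G|`, against maximality. A cover exists because a stem extension has at most `|G|²`
commutators, so Schur's theorem bounds `E'`, hence the kernel, hence `E`. -/

open scoped commutatorElement

/-- The central extension of a group `A` by the additive group of a ring `R` with cocycle
`(x, y) ↦ a x * b y`. -/
@[ext]
structure HeisenbergProduct {A : Type v} {R : Type} [Group A] [CommRing R]
    (a b : A →* Multiplicative R) : Type v where
  base : A
  fiber : R

namespace HeisenbergProduct

variable {A : Type v} {R : Type} [Group A] [CommRing R] {a b : A →* Multiplicative R}

instance : Mul (HeisenbergProduct a b) :=
  ⟨fun x y => ⟨x.base * y.base,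
    x.fiber + y.fiber + (a x.base).toAdd * (b y.base).toAdd⟩⟩

instance : One (HeisenbergProduct a b) := ⟨⟨1, 0⟩⟩

instance : Inv (HeisenbergProduct a b) :=
  ⟨fun x => ⟨x.base⁻¹, -x.fiber + (a x.base).toAdd * (b x.base).toAdd⟩⟩

@[simp] lemma base_mul (x y : HeisenbergProduct a b) : (x * y).base = x.base * y.base := rfl

@[simp] lemma fiber_mul (x y : HeisenbergProduct a b) :
    (x * y).fiber = x.fiber + y.fiber + (a x.base).toAdd * (b y.base).toAdd := rfl

@[simp] lemma base_one : (1 : HeisenbergProduct a b).base = 1 := rfl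

@[simp] lemma fiber_one : (1 : HeisenbergProduct a b).fiber = 0 := rfl

@[simp] lemma base_inv (x : HeisenbergProduct a b) : x⁻¹.base = x.base⁻¹ := rfl

@[simp] lemma fiber_inv (x : HeisenbergProduct a b) :
    x⁻¹.fiber = -x.fiber + (a x.base).toAdd * (b x.base).toAdd := rfl

instance : Group (HeisenbergProduct a b) :=
  Group.ofLeftAxioms
    (fun x y z => by
      ext
      · simp [mul_assoc]
      · simp only [fiber_mul, base_mul, map_mul, toAdd_mul]; ring)
    (fun x => by ext <;> simp)
    (fun x => by ext <;> simp)

variable (a b) in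
/-- The Heisenberg product as a group extension. -/
def extension : GroupExtension (ULift.{v} (Multiplicative R)) (HeisenbergProduct a b) A where
  inl :=
    { toFun := fun r => ⟨1, r.down.toAdd⟩
      map_one' := rfl
      map_mul' := fun r s => by ext <;> simp }
  rightHom :=
    { toFun := base
      map_one' := rfl
      map_mul' := fun _ _ => rfl }
  inl_injective := fun r s h => ULift.ext _ _ (congrArg fiber h)
  range_inl_eq_ker_rightHom := by
    ext x
    constructor
    · rintro ⟨r, rfl⟩
      rfl
    · intro hx
      exact ⟨⟨.ofAdd x.fiber⟩, HeisenbergProduct.ext (Eq.symm hx) rfl⟩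
  rightHom_surjective := fun x => ⟨⟨x, 0⟩, rfl⟩

lemma extension_isCentral : (extension a b).IsCentral := by
  rintro _ ⟨r, rfl⟩
  rw [Subgroup.mem_center_iff]
  intro x
  ext
  · simp [extension]
  · simp [extension, add_comm]

end HeisenbergProduct

/-- If `A` is abelian and `(a, b)` hits both coordinate vectors of `(ZMod d)²`, then the
Heisenberg product is a stem extension. -/
lemma HeisenbergProduct.extension_isStem {A : Type v} [CommGroup A] {d : ℕ}
    {a b : A →* Multiplicative (ZMod d)} {g h : A}
    (hag : a g = .ofAdd 1) (hbg : b g = 1) (hbh : b h = .ofAdd 1) :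
    (extension a b).IsStem := by
  refine ⟨extension_isCentral, ?_⟩
  -- The commutator of lifts of `g` and `h` has fiber `a g * b h - a h * b g`, which is 1 since `b
  -- g` is trivial, whatever `a h` is. This additive generator yields the whole kernel.
  have key : (extension a b).inl ⟨.ofAdd 1⟩ ∈ commutator (HeisenbergProduct a b) := by
    have : (extension a b).inl ⟨.ofAdd 1⟩ =
        ⁅(⟨g, 0⟩ : HeisenbergProduct a b), (⟨h, 0⟩ : HeisenbergProduct a b)⁆ := by
      rw [commutatorElement_def, eq_mul_inv_iff_mul_eq, eq_mul_inv_iff_mul_eq]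
      ext
      · simp [extension, mul_comm]
      · simp [extension, hag, hbg, hbh]
    rw [this]
    exact Subgroup.commutator_mem_commutator (Subgroup.mem_top _) (Subgroup.mem_top _)
  rintro _ ⟨⟨r⟩, rfl⟩
  obtain ⟨n, hn⟩ := ZMod.intCast_surjective r.toAdd
  have hr : (⟨r⟩ : ULift.{v} (Multiplicative (ZMod d))) = ⟨.ofAdd 1⟩ ^ n := by
    apply ULift.ext
    apply Multiplicative.toAdd.injective
    simp [← hn]
  rw [hr, map_zpow]
  exact Subgroup.zpow_mem _ key n

/-- A finite abelian group that is not cyclic has `(ZMod d)²` as a quotient for some `d > 1`. -/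
lemma CommGroup.exists_hom_zmod_of_not_isCyclic (A : Type*) [CommGroup A] [Finite A]
    (hA : ¬ IsCyclic A) :
    ∃ (d : ℕ) (a b : A →* Multiplicative (ZMod d)) (g h : A), 1 < d ∧
      a g = .ofAdd 1 ∧ b g = 1 ∧ a h = 1 ∧ b h = .ofAdd 1 := by
  classical
  obtain ⟨ι, _, n, hn, ⟨e⟩⟩ := CommGroup.equiv_prod_multiplicative_zmod_of_finite A
  -- With pairwise coprime factors the Chinese remainder theorem would make `A` cyclic. Hence two
  -- factors share a divisor, and `d` is their gcd.
  have hnc : ¬ Pairwise (Function.onFun Nat.Coprime n) := by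
    intro hc
    have e' : A ≃* Multiplicative (ZMod (∏ i, n i)) :=
      (e.trans (MulEquiv.piMultiplicative _).symm).trans
        (ZMod.prodEquivPi n hc).toAddEquiv.symm.toMultiplicative
    exact hA (isCyclic_of_surjective e'.symm e'.symm.surjective)
  simp only [Pairwise, not_forall] at hnc
  obtain ⟨i, j, hij, hc⟩ := hnc
  let red (k : ι) (hk : (n i).gcd (n j) ∣ n k) : A →* Multiplicative (ZMod ((n i).gcd (n j))) :=
    ((ZMod.castHom hk (ZMod ((n i).gcd (n j)))).toAddMonoidHom.toMultiplicative.comp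
      (Pi.evalMonoidHom (fun i => Multiplicative (ZMod (n i))) k)).comp e.toMonoidHom
  have hself (k : ι) (hk) : red k hk (e.symm (Pi.mulSingle k (.ofAdd 1))) = .ofAdd 1 := by
    simp [red, ZMod.cast_one hk]
  have hne (k l : ι) (hk) (h : k ≠ l) : red k hk (e.symm (Pi.mulSingle l (.ofAdd 1))) = 1 := by
    simp [red, Pi.mulSingle_eq_of_ne h]
  refine ⟨(n i).gcd (n j), red i (Nat.gcd_dvd_left _ _), red j (Nat.gcd_dvd_right _ _),
    e.symm (Pi.mulSingle i (.ofAdd 1)), e.symm (Pi.mulSingle j (.ofAdd 1)), ?_,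
    hself _ _, hne _ _ _ hij.symm, hne _ _ _ hij, hself _ _⟩
  have := Nat.gcd_pos_of_pos_left (n j) (zero_lt_one.trans (hn i))
  have hc : (n i).gcd (n j) ≠ 1 := hc
  omega

/-! ### Stem extensions and Schur covers -/

namespace GroupExtension

/-- Transport of a group extension along an isomorphism of the quotient. -/
def congrRight {N E : Type v} {A : Type*} {G : Type u} [Group N] [Group E] [Group A] [Group G]
    (S : GroupExtension N E A) (e : A ≃* G) : GroupExtension N E G where
  inl := S.inl
  rightHom := e.toMonoidHom.comp S.rightHom
  inl_injective := S.inl_injective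
  range_inl_eq_ker_rightHom := by
    rw [S.range_inl_eq_ker_rightHom]
    exact (MonoidHom.ker_mulEquiv_comp S.rightHom e).symm
  rightHom_surjective := e.surjective.comp S.rightHom_surjective

variable {N E : Type v} {G : Type u} [Group N] [Group E] [Group G]

lemma card_eq_mul (S : GroupExtension N E G) : Nat.card E = Nat.card N * Nat.card G := by
  rw [← S.rightHom.ker.card_mul_index, Subgroup.index_ker,
    MonoidHom.range_eq_top.mpr S.rightHom_surjective, Subgroup.card_top,
    ← S.range_inl_eq_ker_rightHom,
    Nat.card_congr (MonoidHom.ofInjective S.inl_injective).toEquiv]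

lemma finite_of_finite (S : GroupExtension N E G) [Finite N] [Finite G] : Finite E := by
  refine Nat.finite_of_card_ne_zero ?_
  rw [S.card_eq_mul]
  exact mul_ne_zero Finite.card_pos.ne' Finite.card_pos.ne'

/-- In a central extension, elements with the same image in the quotient differ by a central
element. -/
lemma IsCentral.exists_mem_center {S : GroupExtension N E G} (hS : S.IsCentral) {x y : E}
    (h : S.rightHom x = S.rightHom y) : ∃ z ∈ Subgroup.center E, x = y * z := by
  refine ⟨y⁻¹ * x, hS ?_, by group⟩
  rw [S.range_inl_eq_ker_rightHom, MonoidHom.mem_ker, map_mul, map_inv, h, inv_mul_cancel]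

/-- In a central extension, commutators depend only on the images in the quotient. -/
lemma IsCentral.commutatorElement_congr {S : GroupExtension N E G} (hS : S.IsCentral)
    {x x' y y' : E} (hx : S.rightHom x = S.rightHom x') (hy : S.rightHom y = S.rightHom y') :
    ⁅x, y⁆ = ⁅x', y'⁆ := by
  obtain ⟨z, hz, rfl⟩ := hS.exists_mem_center hx
  obtain ⟨w, hw, rfl⟩ := hS.exists_mem_center hy
  have hz' (t : E) : t * z = z * t := Subgroup.mem_center_iff.mp hz t
  have hw' (t : E) : t * w = w * t := Subgroup.mem_center_iff.mp hw t
  simp only [commutatorElement_def]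
  rw [eq_mul_inv_iff_mul_eq, eq_mul_inv_iff_mul_eq, mul_inv_rev, mul_inv_rev]
  calc x' * z * (y' * w) * (z⁻¹ * x'⁻¹) * (w⁻¹ * y'⁻¹) * y' * x'
      = x' * (z * (y' * w)) * z⁻¹ * x'⁻¹ * w⁻¹ * x' := by group
    _ = x' * y' * (w * x'⁻¹) * w⁻¹ * x' := by rw [← hz']; group
    _ = x' * y' := by rw [← hw']; group

lemma IsCentral.finite_commutatorSet [Finite G] {S : GroupExtension N E G} (hS : S.IsCentral) :
    (commutatorSet E).Finite ∧ (commutatorSet E).ncard ≤ Nat.card (G × G) := by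
  let f : G × G → E := fun p =>
    ⁅Function.surjInv S.rightHom_surjective p.1, Function.surjInv S.rightHom_surjective p.2⁆
  have hsub : commutatorSet E ⊆ Set.range f := by
    rintro _ ⟨x, y, rfl⟩
    exact ⟨(S.rightHom x, S.rightHom y), hS.commutatorElement_congr
      (Function.surjInv_eq _ _) (Function.surjInv_eq _ _)⟩
  refine ⟨(Set.finite_range f).subset hsub, (Set.ncard_le_ncard hsub (Set.finite_range f)).trans ?_⟩
  rw [← Set.image_univ, ← Set.ncard_univ]
  exact Set.ncard_image_le

/-- A stem extension of a finite group is finite, of order bounded in terms of the group. -/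
lemma IsStem.finite_and_card_le [Finite G] {S : GroupExtension N E G} (hS : S.IsStem) :
    Finite E ∧
      Nat.card E ≤ Subgroup.cardCommutatorBound (Nat.card (G × G)) * Nat.card G := by
  obtain ⟨hfin, hcard⟩ := hS.1.finite_commutatorSet
  have := hfin.to_subtype
  -- The stem condition embeds `N` in the derived subgroup, which is finite by Schur's theorem.
  have hinj : Function.Injective fun n : N => (⟨S.inl n, hS.2 ⟨n, rfl⟩⟩ : commutator E) :=
    fun m n h => S.inl_injective (congrArg Subtype.val h)
  have := Finite.of_injective _ hinj
  refine ⟨S.finite_of_finite, ?_⟩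
  rw [S.card_eq_mul]
  refine Nat.mul_le_mul_right _ ((Nat.card_le_card_of_injective _ hinj).trans
    ((Subgroup.card_commutator_le_of_finite_commutatorSet E).trans ?_))
  have hpos : 0 < Nat.card (G × G) := Finite.card_pos
  have hcard : Nat.card (commutatorSet E) ≤ Nat.card (G × G) := hcard
  unfold Subgroup.cardCommutatorBound
  have hpos' : 0 < Nat.card (commutatorSet E) := Finite.card_pos
  gcongr
  exact Nat.one_le_pow _ _ hpos

/-- A finite group is a stem extension of itself by the trivial group. -/
lemma exists_isStem (G : Type u) [Group G] [Finite G] :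
    ∃ (N E : Type v) (_ : Group N) (_ : Group E) (S : GroupExtension N E G), S.IsStem := by
  let e : Shrink.{v} G ≃* G := Shrink.mulEquiv
  refine ⟨PUnit, Shrink.{v} G, inferInstance, inferInstance,
    { inl := 1
      rightHom := e.toMonoidHom
      inl_injective := fun _ _ _ => rfl
      range_inl_eq_ker_rightHom := ?_
      rightHom_surjective := e.surjective }, ?_, ?_⟩
  · rw [MonoidHom.range_one]
    exact ((MonoidHom.ker_eq_bot_iff _).mpr e.injective).symm
  · simp [IsCentral]
  · simp

lemma exists_isSchurCover (G : Type u) [Group G] [Finite G] :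
    ∃ (N E : Type v) (_ : Group N) (_ : Group E) (S : GroupExtension N E G), S.IsSchurCover := by
  let orders : Set ℕ := {k | ∃ (N E : Type v) (_ : Group N) (_ : Group E)
    (S : GroupExtension N E G), S.IsStem ∧ Nat.card E = k}
  have hne : orders.Nonempty := by
    obtain ⟨N, E, _, _, S, hS⟩ := exists_isStem.{u, v} G
    exact ⟨_, N, E, _, _, S, hS, rfl⟩
  have hbdd : BddAbove orders := by
    refine ⟨Subgroup.cardCommutatorBound (Nat.card (G × G)) * Nat.card G, ?_⟩
    rintro _ ⟨N, E, _, _, S, hS, rfl⟩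
    exact hS.finite_and_card_le.2
  obtain ⟨N, E, _, _, S, hS, hk⟩ := Nat.sSup_mem hne hbdd
  refine ⟨N, E, _, _, S, hS, fun N' E' _ _ S' hS' => ?_⟩
  -- `Nat.card` vanishes on infinite groups, so finiteness is needed to compare orders in `ℕ∞`.
  have := hS.finite_and_card_le.1
  have := hS'.finite_and_card_le.1
  rw [ENat.card_eq_coe_natCard, ENat.card_eq_coe_natCard, Nat.cast_le, hk]
  exact le_csSup hbdd ⟨N', E', _, _, S', hS', rfl⟩

lemma IsCentral.deepCommutingGraph_eq_top_iff {S : GroupExtension N E G} (hS : S.IsCentral) :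
    S.deepCommutingGraph = ⊤ ↔ ∀ a b : E, Commute a b := by
  constructor
  · intro h a b
    by_cases hab : S.rightHom a = S.rightHom b
    -- Adjacency says nothing about two lifts of one element; here `⁅a, b⁆ = ⁅b, b⁆ = 1`.
    · rw [← commutatorElement_eq_one_iff_commute, hS.commutatorElement_congr hab rfl,
        commutatorElement_self]
    · have : S.deepCommutingGraph.Adj (S.rightHom a) (S.rightHom b) := by rw [h]; exact hab
      exact this.2 a b rfl rfl
  · intro h
    ext x y
    exact ⟨fun hxy => hxy.1, fun hxy => ⟨hxy, fun a b _ _ => h a b⟩⟩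

/-- A finite group with an abelian Schur cover is cyclic. -/
lemma IsSchurCover.isCyclic_of_commute [Finite G] {S : GroupExtension N E G}
    (hS : S.IsSchurCover) (h : ∀ a b : E, Commute a b) : IsCyclic G := by
  have hinj : Function.Injective S.rightHom := by
    rw [← MonoidHom.ker_eq_bot_iff, ← S.range_inl_eq_ker_rightHom, eq_bot_iff]
    refine hS.1.2.trans ?_
    rw [commutator_def, Subgroup.commutator_le]
    intro a _ b _
    exact commutatorElement_eq_one_iff_commute.mpr (h a b)
  let e : E ≃* G := MulEquiv.ofBijective S.rightHom ⟨hinj, S.rightHom_surjective⟩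
  -- Working over `E` rather than `G` keeps the larger extension in `Type v`, where maximality
  -- applies; `congrRight` then carries it to `G`.
  let _ : CommGroup E := { (inferInstance : Group E) with mul_comm := h }
  have : Finite E := hS.1.finite_and_card_le.1
  by_contra hG
  have hE : ¬ IsCyclic E := fun _ => hG (isCyclic_of_surjective e e.surjective)
  obtain ⟨d, a, b, g, g', hd, hag, hbg, -, hbg'⟩ :=
    CommGroup.exists_hom_zmod_of_not_isCyclic E hE
  have : NeZero d := ⟨by omega⟩
  let T := (HeisenbergProduct.extension a b).congrRight e
  have hT : T.IsStem := HeisenbergProduct.extension_isStem hag hbg hbg'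
  have := hT.finite_and_card_le.1
  have hle := hS.2 _ _ T hT
  rw [ENat.card_eq_coe_natCard, ENat.card_eq_coe_natCard, Nat.cast_le, T.card_eq_mul,
    Nat.card_congr e.toEquiv, Nat.card_congr Equiv.ulift,
    Nat.card_congr Multiplicative.toAdd, Nat.card_zmod] at hle
  have : 0 < Nat.card G := Finite.card_pos
  -- `hle` now reads `d * |G| ≤ |G|`, contrary to `1 < d`.
  nlinarith

end GroupExtension

theorem mainTheorem1 (G : Type u) [Group G] [Finite G] :
    (∃ (N E : Type v) (_ : Group N) (_ : Group E) (S : GroupExtension N E G), S.IsSchurCover) ∧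
    ∀ (N E : Type v) [Group N] [Group E] (S : GroupExtension N E G), S.IsSchurCover →
      (S.deepCommutingGraph = ⊤ ↔ IsCyclic G) := by

  refine ⟨GroupExtension.exists_isSchurCover G, fun N E _ _ S hS => ?_⟩
  rw [hS.1.1.deepCommutingGraph_eq_top_iff]
  refine ⟨hS.isCyclic_of_commute, fun _ a b => ?_⟩
  have hker : S.rightHom.ker ≤ Subgroup.center E := S.range_inl_eq_ker_rightHom ▸ hS.1.1
  exact (S.rightHom.isMulCommutative_of_isCyclic_of_ker_le_center hker).is_comm.comm a b
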